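/- Let $\tau$ be a complex number with $\operatorname{Im}\tau>0$, let $\Gamma_\tau=\mathbb Z+\tau\mathbb Z$, let $X=\mathbb C/\Gamma_\tau$, and write $[z]\in X$ for the class of $z\in\mathbb C$. For distinct points $P_1,P_2\in X$ let $\rho:X\to X_{\{P_1,P_2\}}$ be the quotient of the topological space $X$ obtained by identifying $P_1$ with $P_2$ to one point $Q$; it is the reduced complex space (an irreducible curve of genus $2$ whose only singularity is the node $Q$) whose structure sheaf consists of those functions $g$ such that $g\circ\rho$ is holomorphic and, if $g$ is defined near $Q$, the germ of $g\circ\rho$ along $\{P_1,P_2\}$ is the sum of a constant and a germ vanishing to order at least $1$ at both $P_1$ and $P_2$. Two such curves are called biholomorphic if there is an isomorphism of reduced complex spaces between them, i.e. a homeomorphism under which the sections of the structure sheaves correspond. Let $z_1,z_2,z_1',z_2'\in\mathbb C$ with $[z_1]\ne[z_2]$ and $[z_1']\ne[z_2']$, and put $X_{\mathfrak m}=X_{\{[z_1],[z_2]\}}$ and $X_{\mathfrak m'}=X_{\{[z_1'],[z_2']\}}$. Then $X_{\mathfrak m}$ and $X_{\mathfrak m'}$ are biholomorphic if and only if there is a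 complex number $\gamma$ with $$z_1'-z_2'\equiv\gamma\,(z_1-z_2)\pmod{\Gamma_\tau}$$ such that $\gamma^4=1$ if $\Gamma_\tau$ is square (that is, $\Gamma_\tau=\mathbb Z\omega+\mathbb Z i\omega$ for some $\omega\in\mathbb C\setminus\{0\}$), $\gamma^6=1$ if $\Gamma_\tau$ is hexagonal (that is, $\Gamma_\tau=\mathbb Z\omega+\mathbb Z e^{\pi i/3}\omega$ for some $\omega\in\mathbb C\setminus\{0\}$), and $\gamma=\pm1$ if $\Gamma_\tau$ is neither square nor hexagonal. -/

import Mathlib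

namespace SingularCurve

/-- The subgroup `ℤ a + ℤ b` of `ℂ`. -/
def intSpan (a b : ℂ) : AddSubgroup ℂ :=
  AddSubgroup.zmultiples a ⊔ AddSubgroup.zmultiples b

/-- The lattice `Γ_τ = ℤ + τ ℤ`. -/
def lattice (τ : UpperHalfPlane) : AddSubgroup ℂ := intSpan 1 (τ : ℂ)

/-- The complex torus `ℂ / Γ_τ`, with its quotient topology; the class `[z]` of `z : ℂ` is
`(z : Torus τ)`. -/
abbrev Torus (τ : UpperHalfPlane) : Type := ℂ ⧸ lattice τ

/-- `φ` is holomorphic near `P`: its pull-back to `ℂ` is analytic at the points over `P`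
(`ℂ → ℂ / Γ_τ` is the universal covering, so its local inverses are the charts of the torus).
Only the germ of `φ` at `P` matters. -/
def IsHolomorphicAt {τ : UpperHalfPlane} (φ : Torus τ → ℂ) (P : Torus τ) : Prop :=
  ∀ z : ℂ, (z : Torus τ) = P → AnalyticAt ℂ (fun w : ℂ => φ (w : Torus τ)) z

/-- `ord_P φ ≥ n`, for `φ` holomorphic near `P`. -/
def OrdGE {τ : UpperHalfPlane} (φ : Torus τ → ℂ) (P : Torus τ) (n : ℕ) : Prop :=
  ∀ z : ℂ, (z : Torus τ) = P → (n : ℕ∞) ≤ analyticOrderAt (fun w : ℂ => φ (w : Torus τ)) z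

/-- A modulus on the set `X` together with the equivalence relation used for gluing:
a finite support `S`, an equivalence relation on `S` and a positive integer for each point
of `S`. -/
structure Modulus (X : Type) where
  /-- the support -/
  S : Set X
  finite_S : S.Finite
  /-- the equivalence relation on the support -/
  R : Setoid S
  /-- the multiplicities -/
  mult : S → ℕ
  mult_pos : ∀ P, 0 < mult P

/-- The equivalence relation on `X` which glues the points of `S` according to `R`, and no
other points. -/
def Modulus.glue {X : Type} (m : Modulus X) : Setoid X where
  r P Q := P = Q ∨ ∃ (hP : P ∈ m.S) (hQ : Q ∈ m.S), m.R ⟨P, hP⟩ ⟨Q, hQ⟩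
  iseqv :=
    { refl := fun _ => Or.inl rfl
      symm := by
        rintro P Q (h | ⟨hP, hQ, h⟩)
        · exact Or.inl h.symm
        · exact Or.inr ⟨hQ, hP, m.R.symm h⟩
      trans := by
        rintro P Q T (rfl | ⟨hP, hQ, h⟩) (rfl | ⟨hQ', hT, h'⟩)
        · exact Or.inl rfl
        · exact Or.inr ⟨hQ', hT, h'⟩
        · exact Or.inr ⟨hP, hQ, h⟩
        · exact Or.inr ⟨hP, hT, m.R.trans h h'⟩ }

/-- The underlying space `(X \ S) ∪ S / R` of the singular curve `X_m`, with the quotient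
topology. -/
abbrev Modulus.Curve {X : Type} (m : Modulus X) : Type := Quotient m.glue

/-- The projection `ρ : X → X_m`. -/
def Modulus.proj {X : Type} (m : Modulus X) : X → m.Curve := Quotient.mk m.glue

/-- The germ of `g` at `Q` belongs to the stalk `O_{m,Q}`: the germ of `g ∘ ρ` along the fibre
over `Q` is holomorphic, and, if `Q` is the image of points of `S`, it lies in `ℂ + I_Q`, where
`I_Q` is the ideal of the germs of order at least `m(P)` at each `P ∈ ρ⁻¹(Q)`. (For `Q` outside
the image of `S` the second condition is empty.) -/
def Modulus.MemStalk {τ : UpperHalfPlane} (m : Modulus (Torus τ)) (g : m.Curve → ℂ)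
    (Q : m.Curve) : Prop :=
  (∀ P : Torus τ, m.proj P = Q → IsHolomorphicAt (g ∘ m.proj) P) ∧
  ∃ c : ℂ, ∀ P : m.S, m.proj P = Q → OrdGE (fun x => g (m.proj x) - c) P (m.mult P)

/-- The sections of the structure sheaf `O_m` over `V`, as functions on the reduced complex
space `X_m`. The values outside `V` are irrelevant. -/
def Modulus.sections {τ : UpperHalfPlane} (m : Modulus (Torus τ))
    (V : TopologicalSpace.Opens m.Curve) : Set (m.Curve → ℂ) :=
  {g | ∀ Q ∈ V, m.MemStalk g Q}

/-- `X_m` and `X_m'` are biholomorphic: there is an isomorphism of reduced complex spaces, that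
is, a homeomorphism under which the sections of the structure sheaves correspond. -/
def Biholomorphic {τ τ' : UpperHalfPlane} (m : Modulus (Torus τ)) (m' : Modulus (Torus τ')) :
    Prop :=
  ∃ f : m.Curve ≃ₜ m'.Curve, ∀ (V : TopologicalSpace.Opens m'.Curve) (g : m'.Curve → ℂ),
    g ∈ m'.sections V ↔
      g ∘ f ∈ m.sections (TopologicalSpace.Opens.comap ⟨f, f.continuous⟩ V)

/-- The modulus with support `{P₁, P₂}`, both points identified and both multiplicities `1`.
For `P₁ ≠ P₂` the associated curve has one node as its only singularity, and for a torus its genus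
is `1 + (2 - 1) = 2`. -/
def nodeModulus {X : Type} (P₁ P₂ : X) : Modulus X where
  S := {P₁, P₂}
  finite_S := Set.toFinite _
  R := ⊤
  mult := fun _ => 1
  mult_pos := fun _ => Nat.one_pos

/-- `Γ_τ` is a square lattice: it is generated by the sides `ω`, `i ω` of a square. -/
def IsSquareLattice (τ : UpperHalfPlane) : Prop :=
  ∃ ω : ℂ, ω ≠ 0 ∧ lattice τ = intSpan ω (Complex.I * ω)

/-- `Γ_τ` is a hexagonal lattice: it is generated by the sides `ω`, `e^{π i / 3} ω` of an
equilateral triangle. -/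
def IsHexagonalLattice (τ : UpperHalfPlane) : Prop :=
  ∃ ω : ℂ, ω ≠ 0 ∧ lattice τ = intSpan ω (Complex.exp (Real.pi * Complex.I / 3) * ω)

/-- `γ` is a 4th root of unity if `Γ_τ` is square, a 6th root of unity if `Γ_τ` is hexagonal, and
`±1` otherwise. -/
def IsAdmissible (τ : UpperHalfPlane) (γ : ℂ) : Prop :=
  (IsSquareLattice τ ∧ γ ^ 4 = 1) ∨ (IsHexagonalLattice τ ∧ γ ^ 6 = 1) ∨
    (¬ IsSquareLattice τ ∧ ¬ IsHexagonalLattice τ ∧ (γ = 1 ∨ γ = -1))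

end SingularCurve

/-!
An isomorphism `f` between two nodal curves over the torus `X = ℂ / Γ_τ` is induced by an affine map
of the plane, and this reduces the statement to a question on lattices.

The composition of `f` with `ρ : X → X_m` meets the node in finitely many points, and elsewhere it
lifts to `X`. Near an exceptional point the lift has a limit, because a connected punctured
neighbourhood cannot be spread over both branches of the node (`exists_tendsto_out`); so there is a
continuous `φ : X → X` over `f` (`exists_continuous_lift`). Since `ℂ` is simply connected, `φ` lifts
to a continuous `F : ℂ → ℂ`. It is holomorphic off a discrete set, because `f` pulls back local
coordinates of `X` to sections of the structure sheaf, and hence entire by Riemann's theorem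
(`differentiable_lift`). Its derivative is doubly periodic, so `F z = γ z + β` by Liouville's theorem
(`exists_affine_of_lift`). Injectivity of `f` gives `γ Γ_τ = Γ_τ`, and `φ` maps the two points over
one node to the two points over the other, possibly in reverse order, whence the congruence for `γ`
or for `-γ`. It is not necessary to know beforehand that `f` maps the node to the node.

If `γ Γ_τ = Γ_τ`, then `|γ| = 1` and `2 Re γ` is an integer, so `γ` is a root of unity of order
`1`, `2`, `3`, `4` or `6`, and division with remainder by a shortest vector shows that the lattice is
square or hexagonal unless `γ = ±1` (`isAdmissible_of_mem_multipliers`). Conversely an admissible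
`γ` satisfies `γ Γ_τ = Γ_τ`, and the affine map `z ↦ γ (z - z₁) + z₁'` descends to the nodal
curves (`biholomorphic_of_affine`).
-/

open Filter Topology

namespace SingularCurve

/-! ### Lattices and their multipliers -/

theorem mem_intSpan {a b x : ℂ} : x ∈ intSpan a b ↔ ∃ m n : ℤ, (m : ℂ) * a + n * b = x := by
  simp only [intSpan, AddSubgroup.mem_sup, AddSubgroup.mem_zmultiples_iff, zsmul_eq_mul]
  constructor
  · rintro ⟨_, ⟨m, rfl⟩, _, ⟨n, rfl⟩, h⟩
    exact ⟨m, n, h⟩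
  · rintro ⟨m, n, h⟩
    exact ⟨_, ⟨m, rfl⟩, _, ⟨n, rfl⟩, h⟩

theorem mem_lattice {τ : UpperHalfPlane} {x : ℂ} :
    x ∈ lattice τ ↔ ∃ m n : ℤ, (m : ℂ) + n * (τ : ℂ) = x := by
  simp [lattice, mem_intSpan]

theorem one_mem_lattice (τ : UpperHalfPlane) : (1 : ℂ) ∈ lattice τ :=
  mem_lattice.2 ⟨1, 0, by simp⟩

/-- A real number in `Γ_τ` is an integer. -/
theorem exists_int_of_real_mem_lattice {τ : UpperHalfPlane} {t : ℝ} (h : (t : ℂ) ∈ lattice τ) :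
    ∃ m : ℤ, (m : ℝ) = t := by
  obtain ⟨m, n, h⟩ := mem_lattice.1 h
  have him := congrArg Complex.im h
  have hre := congrArg Complex.re h
  simp at him hre
  have hn : n = 0 := him.resolve_right τ.im_pos.ne'
  exact ⟨m, by simpa [hn] using hre⟩

instance (τ : UpperHalfPlane) : DiscreteTopology (lattice τ) := by
  have hτ : 0 < (τ : ℂ).im := τ.im_pos
  rw [discreteTopology_iff_isOpen_singleton_zero, isOpen_induced_iff]
  refine ⟨Metric.ball 0 (min 1 (τ : ℂ).im), Metric.isOpen_ball, ?_⟩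
  ext ⟨x, hx⟩
  simp only [Set.mem_preimage, mem_ball_zero_iff, Set.mem_singleton_iff, lt_min_iff,
    AddSubgroup.mk_eq_zero]
  refine ⟨fun ⟨h1, h2⟩ => ?_, by rintro rfl; simpa using hτ⟩
  obtain ⟨m, n, rfl⟩ := mem_lattice.1 hx
  have him := (Complex.abs_im_le_norm _).trans_lt h2
  have hn : n = 0 := by
    simp only [Complex.add_im, Complex.intCast_im, Complex.mul_im, Complex.intCast_re, zero_mul,
      add_zero, zero_add, abs_mul, abs_of_pos hτ] at him
    have : |(n : ℝ)| < 1 := by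
      by_contra! hc
      nlinarith
    exact Int.abs_lt_one_iff.1 (by exact_mod_cast this)
  subst hn
  have hm : m = 0 := by
    simp only [Int.cast_zero, zero_mul, add_zero, Complex.norm_intCast] at h1
    exact Int.abs_lt_one_iff.1 (by exact_mod_cast h1)
  simp [hm]

instance (τ : UpperHalfPlane) : IsClosed (lattice τ : Set ℂ) := AddSubgroup.isClosed_of_discrete

/-- A lattice has a shortest nonzero vector. -/
theorem exists_shortest (τ : UpperHalfPlane) :
    ∃ ω ∈ lattice τ, ω ≠ 0 ∧ ∀ v ∈ lattice τ, v ≠ 0 → ‖ω‖ ≤ ‖v‖ := by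
  have hfin : (Metric.closedBall (0 : ℂ) 1 ∩ (lattice τ : Set ℂ)).Finite :=
    Metric.finite_isBounded_inter_isClosed
      (isDiscrete_iff_discreteTopology.2 (inferInstanceAs (DiscreteTopology (lattice τ))))
      Metric.isBounded_closedBall inferInstance
  obtain ⟨ω, ⟨⟨h1, h2⟩, h0⟩, hmin⟩ := Set.exists_min_image _ (fun v : ℂ => ‖v‖)
    (hfin.subset (Set.sdiff_subset (t := {0}))) ⟨1, by simpa using one_mem_lattice τ⟩
  refine ⟨ω, h2, by simpa using h0, fun v hv hv0 => ?_⟩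
  by_cases hle : ‖v‖ ≤ 1
  · exact hmin v ⟨⟨by simpa using hle, hv⟩, by simpa using hv0⟩
  · exact (by simpa using h1 : ‖ω‖ ≤ 1).trans (not_le.1 hle).le

/-- The ring of multipliers of `Λ`: the complex numbers `γ` with `γ Λ ⊆ Λ`. -/
def multipliers (Λ : AddSubgroup ℂ) : Subring ℂ where
  carrier := {γ | ∀ l ∈ Λ, γ * l ∈ Λ}
  mul_mem' {a b} ha hb l hl := by
    rw [mul_assoc]
    exact ha _ (hb l hl)
  one_mem' l hl := by rwa [one_mul]
  add_mem' {a b} ha hb l hl := by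
    rw [add_mul]
    exact Λ.add_mem (ha l hl) (hb l hl)
  zero_mem' l hl := by
    rw [zero_mul]
    exact Λ.zero_mem
  neg_mem' {a} ha l hl := by
    rw [neg_mul]
    exact Λ.neg_mem (ha l hl)

theorem mem_multipliers {Λ : AddSubgroup ℂ} {γ : ℂ} :
    γ ∈ multipliers Λ ↔ ∀ l ∈ Λ, γ * l ∈ Λ := Iff.rfl

/-- If `η² = a η + b` with integers `a`, `b`, then `η` is a multiplier of `ℤ ω + ℤ η ω`. -/
theorem mem_multipliers_intSpan {η ω : ℂ} (a b : ℤ) (hη : η ^ 2 = a * η + b) :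
    η ∈ multipliers (intSpan ω (η * ω)) := by
  intro l hl
  obtain ⟨m, n, rfl⟩ := mem_intSpan.1 hl
  refine mem_intSpan.2 ⟨n * b, m + n * a, ?_⟩
  push_cast
  linear_combination -(n : ℂ) * ω * hη

/-- If `1, η` span a lattice so dense that every point of the plane has distance less than `1`
from it, and `η` is a multiplier of `Γ_τ`, then `Γ_τ` is generated by `ω` and `η ω`, where `ω` is
a shortest vector: this is division with remainder. -/
theorem exists_lattice_eq_intSpan {τ : UpperHalfPlane} {η : ℂ} (hη : η ∈ multipliers (lattice τ))
    (h0 : 0 < η.im) (h1 : η.im ≤ 1) : ∃ ω : ℂ, ω ≠ 0 ∧ lattice τ = intSpan ω (η * ω) := by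
  obtain ⟨ω, hω, hω0, hmin⟩ := exists_shortest τ
  refine ⟨ω, hω0, le_antisymm (fun v hv => ?_) (fun v hv => ?_)⟩
  · set n : ℤ := round ((v / ω).im / η.im) with hn
    set m : ℤ := round ((v / ω).re - n * η.re) with hm
    have hrem : v - (m * ω + n * (η * ω)) ∈ lattice τ := by
      refine sub_mem hv (add_mem ?_ ?_)
      · simpa using (lattice τ).zsmul_mem hω m
      · simpa using (lattice τ).zsmul_mem (hη ω hω) n
    have hsmall : ‖v / ω - (m + n * η)‖ < 1 := by
      have hre : |(v / ω - (m + n * η)).re| ≤ 1 / 2 := by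
        have := abs_sub_round ((v / ω).re - n * η.re)
        rw [← hm] at this
        have e : (v / ω - (m + n * η)).re = (v / ω).re - n * η.re - m := by
          simp only [Complex.sub_re, Complex.add_re, Complex.intCast_re, Complex.mul_re,
            Complex.intCast_im, zero_mul, sub_zero]
          ring
        rwa [e]
      have him : |(v / ω - (m + n * η)).im| ≤ 1 / 2 := by
        have := abs_sub_round ((v / ω).im / η.im)
        rw [← hn] at this
        have e : (v / ω - (m + n * η)).im = ((v / ω).im / η.im - n) * η.im := by
          rw [sub_mul, div_mul_cancel₀ _ h0.ne']
          simp
        rw [e, abs_mul, abs_of_pos h0]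
        nlinarith [abs_nonneg ((v / ω).im / η.im - n)]
      rw [← sq_lt_one_iff₀ (norm_nonneg _), Complex.sq_norm, Complex.normSq_apply,
        ← abs_mul_abs_self (v / ω - (m + n * η)).re, ← abs_mul_abs_self (v / ω - (m + n * η)).im]
      nlinarith [abs_nonneg (v / ω - (m + n * η)).re, abs_nonneg (v / ω - (m + n * η)).im]
    have hzero : v - (m * ω + n * (η * ω)) = 0 := by
      by_contra hne
      have hle := hmin _ hrem hne
      have e : v - (m * ω + n * (η * ω)) = (v / ω - (m + n * η)) * ω := by
        field_simp
      rw [e, norm_mul] at hle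
      nlinarith [norm_pos_iff.2 hω0]
    exact mem_intSpan.2 ⟨m, n, (sub_eq_zero.1 hzero).symm⟩
  · obtain ⟨m, n, rfl⟩ := mem_intSpan.1 hv
    refine add_mem ?_ ?_
    · simpa using (lattice τ).zsmul_mem hω m
    · simpa using (lattice τ).zsmul_mem (hη ω hω) n

theorem exp_pi_mul_I_div_three :
    Complex.exp (Real.pi * Complex.I / 3) = ⟨1 / 2, √3 / 2⟩ := by
  have e : (Real.pi * Complex.I / 3 : ℂ) = ((Real.pi / 3 : ℝ) : ℂ) * Complex.I := by
    push_cast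
    ring
  apply Complex.ext
  · rw [e, Complex.exp_ofReal_mul_I_re, Real.cos_pi_div_three]
  · rw [e, Complex.exp_ofReal_mul_I_im, Real.sin_pi_div_three]

theorem exp_pi_mul_I_div_three_sq :
    Complex.exp (Real.pi * Complex.I / 3) ^ 2 = Complex.exp (Real.pi * Complex.I / 3) - 1 := by
  have h3 : √3 * √3 = (3 : ℝ) := Real.mul_self_sqrt (by norm_num)
  rw [exp_pi_mul_I_div_three]
  apply Complex.ext <;> simp [pow_two] <;> nlinarith

theorem isSquareLattice_of_I_mem {τ : UpperHalfPlane} (h : Complex.I ∈ multipliers (lattice τ)) :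
    IsSquareLattice τ :=
  exists_lattice_eq_intSpan h (by simp) (by simp)

theorem isHexagonalLattice_of_exp_mem {τ : UpperHalfPlane}
    (h : Complex.exp (Real.pi * Complex.I / 3) ∈ multipliers (lattice τ)) :
    IsHexagonalLattice τ := by
  refine exists_lattice_eq_intSpan h ?_ ?_ <;> rw [exp_pi_mul_I_div_three]
  · positivity
  · have : √3 ≤ 2 := Real.sqrt_le_iff.2 ⟨by norm_num, by norm_num⟩
    linarith

/-- Admissible numbers map `Γ_τ` onto itself. -/
theorem IsAdmissible.mem_multipliers {τ : UpperHalfPlane} {γ : ℂ} (h : IsAdmissible τ γ) :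
    γ ≠ 0 ∧ γ ∈ multipliers (lattice τ) ∧ γ⁻¹ ∈ multipliers (lattice τ) := by
  -- A root of unity in a ring is a unit of that ring.
  have key : ∀ n : ℕ, γ ^ (n + 1) = 1 → γ ∈ multipliers (lattice τ) →
      γ ≠ 0 ∧ γ ∈ multipliers (lattice τ) ∧ γ⁻¹ ∈ multipliers (lattice τ) := by
    intro n hn hγ
    refine ⟨by rintro rfl; simp at hn, hγ, ?_⟩
    rw [inv_eq_of_mul_eq_one_left (a := γ ^ n) (b := γ) (by rw [← pow_succ, hn])]
    exact pow_mem hγ n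
  rcases h with ⟨⟨ω, -, hω⟩, h⟩ | ⟨⟨ω, -, hω⟩, h⟩ | ⟨-, -, h⟩
  · refine key 3 h ?_
    have hI : Complex.I ∈ multipliers (lattice τ) := by
      rw [hω]
      exact mem_multipliers_intSpan 0 (-1) (by simp)
    have hf : (γ - 1) * (γ + 1) * ((γ - Complex.I) * (γ + Complex.I)) = 0 := by
      linear_combination h - (γ ^ 2 - 1) * Complex.I_sq
    simp only [mul_eq_zero, sub_eq_zero, add_eq_zero_iff_eq_neg] at hf
    rcases hf with (rfl | rfl) | (rfl | rfl)
    · exact one_mem _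
    · exact neg_mem (one_mem _)
    · exact hI
    · exact neg_mem hI
  · refine key 5 h ?_
    set ζ := Complex.exp (Real.pi * Complex.I / 3) with hζ
    have hsq : ζ ^ 2 = ζ - 1 := exp_pi_mul_I_div_three_sq
    have hI : ζ ∈ multipliers (lattice τ) := by
      rw [hω]
      exact mem_multipliers_intSpan 1 (-1) (by rw [hsq]; push_cast; ring)
    have hf : (γ - 1) * (γ + 1) * (((γ - ζ) * (γ - (1 - ζ))) * ((γ + ζ) * (γ + (1 - ζ)))) = 0 := by
      have e1 : (γ - ζ) * (γ - (1 - ζ)) = γ ^ 2 - γ + 1 := by linear_combination -hsq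
      have e2 : (γ + ζ) * (γ + (1 - ζ)) = γ ^ 2 + γ + 1 := by linear_combination -hsq
      rw [e1, e2]
      linear_combination h
    simp only [mul_eq_zero, sub_eq_zero, add_eq_zero_iff_eq_neg] at hf
    rcases hf with (rfl | rfl) | ((rfl | rfl) | (rfl | rfl))
    · exact one_mem _
    · exact neg_mem (one_mem _)
    · exact hI
    · exact sub_mem (one_mem _) hI
    · exact neg_mem hI
    · exact neg_mem (sub_mem (one_mem _) hI)
  · rcases h with rfl | rfl
    · exact key 0 (by simp) (one_mem _)
    · exact key 1 (by simp) (neg_mem (one_mem _))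

/-- Conversely, a number mapping `Γ_τ` onto itself is admissible: it has absolute value `1`
because it preserves the length of a shortest vector, hence `γ + γ⁻¹ = 2 Re γ`; this multiplier is
real, hence an integer between `-2` and `2`. -/
theorem isAdmissible_of_mem_multipliers {τ : UpperHalfPlane} {γ : ℂ} (h0 : γ ≠ 0)
    (h : γ ∈ multipliers (lattice τ)) (h' : γ⁻¹ ∈ multipliers (lattice τ)) :
    IsAdmissible τ γ := by
  have hnorm : ‖γ‖ = 1 := by
    obtain ⟨ω, hω, hω0, hmin⟩ := exists_shortest τ
    have hpos := norm_pos_iff.2 hω0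
    have h1 := hmin _ (h ω hω) (mul_ne_zero h0 hω0)
    have h2 := hmin _ (h' ω hω) (mul_ne_zero (inv_ne_zero h0) hω0)
    rw [norm_mul] at h1 h2
    rw [norm_inv] at h2
    have h3 : 1 ≤ ‖γ‖ := by nlinarith
    have h4 : 1 ≤ ‖γ‖⁻¹ := by nlinarith
    exact le_antisymm (by simpa using inv_le_one_of_one_le₀ h4) h3
  have hsq : γ.re * γ.re + γ.im * γ.im = 1 := by
    rw [← Complex.normSq_apply, ← Complex.sq_norm, hnorm, one_pow]
  have hinv : γ⁻¹ = (starRingEnd ℂ) γ := Complex.inv_eq_conj hnorm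
  obtain ⟨m, hm⟩ : ∃ m : ℤ, (m : ℝ) = 2 * γ.re := by
    apply exists_int_of_real_mem_lattice (τ := τ)
    have := add_mem h h' 1 (one_mem_lattice τ)
    rwa [mul_one, hinv, Complex.add_conj] at this
  have hquad : γ ^ 2 - m * γ + 1 = 0 := by
    apply Complex.ext <;> simp [pow_two, hm] <;> nlinarith
  have hle : |(m : ℝ)| ≤ 2 := by
    rw [hm, abs_le]
    constructor <;> nlinarith [mul_self_nonneg γ.im]
  have hle' : |m| ≤ 2 := by exact_mod_cast hle
  obtain ⟨hl, hu⟩ := abs_le.1 hle'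
  -- The numbers `1` and `-1` are admissible for every lattice.
  have hpm : γ = 1 ∨ γ = -1 → IsAdmissible τ γ := by
    intro hγ
    by_cases hs : IsSquareLattice τ
    · exact Or.inl ⟨hs, by rcases hγ with rfl | rfl <;> norm_num⟩
    · by_cases hh : IsHexagonalLattice τ
      · exact Or.inr (Or.inl ⟨hh, by rcases hγ with rfl | rfl <;> norm_num⟩)
      · exact Or.inr (Or.inr ⟨hs, hh, hγ⟩)
  set ζ := Complex.exp (Real.pi * Complex.I / 3) with hζ
  have hζsq : ζ ^ 2 = ζ - 1 := exp_pi_mul_I_div_three_sq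
  interval_cases m
  · refine hpm (Or.inr ?_)
    have : (γ + 1) ^ 2 = 0 := by
      push_cast at hquad
      linear_combination hquad
    exact eq_neg_of_add_eq_zero_left (pow_eq_zero_iff two_ne_zero |>.1 this)
  · push_cast at hquad
    refine Or.inr (Or.inl ⟨isHexagonalLattice_of_exp_mem ?_, ?_⟩)
    · have hf : (γ + ζ) * (γ + 1 - ζ) = 0 := by linear_combination hquad - hζsq
      rcases mul_eq_zero.1 hf with hf | hf
      · rw [← hζ, show ζ = -γ by linear_combination hf]
        exact neg_mem h
      · rw [← hζ, show ζ = γ + 1 by linear_combination -hf]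
        exact add_mem h (one_mem _)
    · linear_combination (γ ^ 2 - 1) * (γ ^ 2 - γ + 1) * hquad
  · push_cast at hquad
    refine Or.inl ⟨isSquareLattice_of_I_mem ?_, ?_⟩
    · have hf : (γ - Complex.I) * (γ + Complex.I) = 0 := by
        linear_combination hquad - Complex.I_sq
      rcases mul_eq_zero.1 hf with hf | hf
      · rwa [← sub_eq_zero.1 hf]
      · rw [show Complex.I = -γ by linear_combination hf]
        exact neg_mem h
    · linear_combination (γ ^ 2 - 1) * hquad
  · push_cast at hquad
    refine Or.inr (Or.inl ⟨isHexagonalLattice_of_exp_mem ?_, ?_⟩)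
    · have hf : (γ - ζ) * (γ - 1 + ζ) = 0 := by linear_combination hquad - hζsq
      rcases mul_eq_zero.1 hf with hf | hf
      · rwa [← hζ, ← sub_eq_zero.1 hf]
      · rw [← hζ, show ζ = 1 - γ by linear_combination hf]
        exact sub_mem (one_mem _) h
    · linear_combination (γ ^ 2 - 1) * (γ ^ 2 + γ + 1) * hquad
  · refine hpm (Or.inl ?_)
    have : (γ - 1) ^ 2 = 0 := by
      push_cast at hquad
      linear_combination hquad
    exact sub_eq_zero.1 (pow_eq_zero_iff two_ne_zero |>.1 this)

/-! ### The universal covering of the torus -/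

section Torus

variable {τ : UpperHalfPlane}

theorem isCoveringMap_mk (τ : UpperHalfPlane) : IsCoveringMap (fun z : ℂ => (z : Torus τ)) :=
  ((lattice τ).isAddQuotientCoveringMap_of_comm
    (isDiscrete_iff_discreteTopology.2 (inferInstanceAs (DiscreteTopology (lattice τ))))).isCoveringMap

theorem mk_eq_mk {z w : ℂ} : (z : Torus τ) = (w : Torus τ) ↔ w - z ∈ lattice τ := by
  rw [QuotientAddGroup.eq, neg_add_eq_sub]

/-- Near each point, the projection `ℂ → ℂ / Γ_τ` has a left inverse. -/
theorem exists_local_inverse (w : ℂ) : ∃ (h : Torus τ → ℂ) (U : Set ℂ), IsOpen U ∧ w ∈ U ∧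
    ∀ u ∈ U, h (u : Torus τ) = u := by
  obtain ⟨e, hw, he⟩ := (isCoveringMap_mk τ).isLocalHomeomorph w
  refine ⟨e.symm, e.source, e.open_source, hw, fun u hu => ?_⟩
  have := e.left_inv hu
  rwa [← he] at this

theorem tendsto_mk_punctured (z : ℂ) :
    Tendsto (fun w : ℂ => (w : Torus τ)) (𝓝[≠] z) (𝓝[≠] (z : Torus τ)) := by
  obtain ⟨h, U, hU, hzU, hh⟩ := exists_local_inverse (τ := τ) z
  refine tendsto_nhdsWithin_iff.2
    ⟨((isCoveringMap_mk τ).continuous.tendsto z).mono_left nhdsWithin_le_nhds, ?_⟩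
  filter_upwards [self_mem_nhdsWithin, mem_nhdsWithin_of_mem_nhds (hU.mem_nhds hzU)] with w hw hwU e
  exact hw (by rw [← hh w hwU, show (w : Torus τ) = z from e, hh z hzU, Set.mem_singleton_iff])

theorem isPreconnected_punctured_ball {z : ℂ} {r : ℝ} (hr : 0 < r) :
    IsPreconnected (Metric.ball z r \ {z}) := by
  -- The map `w ↦ z + exp w` maps a half plane onto the punctured disc.
  have e : Metric.ball z r \ {z} = (fun w => z + Complex.exp w) '' {w | w.re < Real.log r} := by
    ext x
    simp only [Set.mem_sdiff, mem_ball_iff_norm, Set.mem_singleton_iff, Set.mem_image,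
      Set.mem_ofPred_eq]
    constructor
    · rintro ⟨h1, h2⟩
      have h0 : x - z ≠ 0 := sub_ne_zero.2 h2
      refine ⟨Complex.log (x - z), ?_, by rw [Complex.exp_log h0]; ring⟩
      rw [Complex.log_re]
      exact Real.log_lt_log (norm_pos_iff.2 h0) h1
    · rintro ⟨w, hw, rfl⟩
      refine ⟨?_, by simp [Complex.exp_ne_zero]⟩
      rw [add_sub_cancel_left, Complex.norm_exp]
      exact (Real.lt_log_iff_exp_lt hr).1 hw
  rw [e]
  exact (convex_halfSpace_re_lt _).isPreconnected.image _ (by fun_prop)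

/-- The punctured neighbourhoods of a point of the torus contain connected ones. -/
theorem exists_preconnected_punctured_nhds (P : Torus τ) {T : Set (Torus τ)} (hT : T ∈ 𝓝[≠] P) :
    ∃ W ∈ 𝓝[≠] P, W ⊆ T ∧ IsPreconnected W := by
  obtain ⟨z, rfl⟩ := QuotientAddGroup.mk_surjective P
  obtain ⟨r, hr, hrT⟩ := Metric.mem_nhdsWithin_iff.1 (tendsto_mk_punctured z hT)
  refine ⟨(fun w : ℂ => (w : Torus τ)) '' (Metric.ball z r \ {z}), ?_, ?_,
    (isPreconnected_punctured_ball hr).image _ (isCoveringMap_mk τ).continuous.continuousOn⟩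
  · have hopen := (isCoveringMap_mk τ).isOpenMap.image_mem_nhds (Metric.ball_mem_nhds z hr)
    filter_upwards [self_mem_nhdsWithin, mem_nhdsWithin_of_mem_nhds hopen] with x hx hxU
    obtain ⟨w, hw, rfl⟩ := hxU
    exact ⟨w, ⟨hw, fun h => hx (by rw [show w = z from h]; rfl)⟩, rfl⟩
  · rintro _ ⟨w, hw, rfl⟩
    exact hrT hw

/-- A continuous self-map of the torus lifts to the plane. -/
theorem exists_lift_plane {φ : Torus τ → Torus τ} (hφ : Continuous φ) :
    ∃ F : ℂ → ℂ, Continuous F ∧ ∀ z : ℂ, (F z : Torus τ) = φ (z : Torus τ) := by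
  obtain ⟨e₀, he₀⟩ := QuotientAddGroup.mk_surjective (φ ((0 : ℂ) : Torus τ))
  obtain ⟨F, ⟨-, hF⟩, -⟩ := (isCoveringMap_mk τ).existsUnique_continuousMap_lifts
    ⟨fun z : ℂ => φ (z : Torus τ), hφ.comp (isCoveringMap_mk τ).continuous⟩ 0 e₀ he₀
  exact ⟨F, F.continuous, fun z => congrFun hF z⟩

/-- An entire function which descends to a self-map of the torus is affine: its derivative is
doubly periodic, hence bounded, hence constant. -/
theorem exists_affine_of_lift {φ : Torus τ → Torus τ} {F : ℂ → ℂ} (hF : Differentiable ℂ F)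
    (hφ : ∀ z : ℂ, (F z : Torus τ) = φ (z : Torus τ)) :
    ∃ γ β : ℂ, ∀ z, F z = γ * z + β := by
  have hτ : (τ : ℂ).im ≠ 0 := τ.im_pos.ne'
  have hper : ∀ l ∈ lattice τ, ∀ z, deriv F (z + l) = deriv F z := by
    intro l hl z
    have hmem : ∀ w, F (w + l) - F w ∈ lattice τ := fun w => by
      rw [← mk_eq_mk, hφ, hφ, mk_eq_mk.2 (show w + l - w ∈ lattice τ by simpa using hl)]
    have hconst : ∀ w, F (w + l) = F w + (F (z + l) - F z) := fun w => by
      have hc : Continuous fun w => (⟨F (w + l) - F w, hmem w⟩ : lattice τ) := by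
        have := hF.continuous
        fun_prop
      have := congrArg Subtype.val (PreconnectedSpace.constant inferInstance hc (x := w) (y := z))
      simp only at this
      linear_combination this
    rw [← deriv_comp_add_const, funext hconst, deriv_add_const]
  have hderiv : Differentiable ℂ (deriv F) := hF.deriv
  have hK : IsCompact ((fun p : ℝ × ℝ => (p.1 : ℂ) + p.2 * (τ : ℂ)) ''
      (Set.Icc 0 1 ×ˢ Set.Icc 0 1)) :=
    (isCompact_Icc.prod isCompact_Icc).image (by fun_prop)
  have hbdd : Bornology.IsBounded (Set.range (deriv F)) := by
    refine (hK.image hderiv.continuous).isBounded.subset ?_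
    rintro _ ⟨z, rfl⟩
    set b : ℝ := z.im / (τ : ℂ).im with hb
    set a : ℝ := z.re - b * (τ : ℂ).re with ha
    have hz : z = a + b * (τ : ℂ) := by
      apply Complex.ext
      · simp [ha]
      · simp only [Complex.add_im, Complex.ofReal_im, Complex.mul_im, Complex.ofReal_re, zero_mul,
          add_zero, zero_add, hb]
        rw [div_mul_cancel₀ _ hτ]
    refine ⟨_, ⟨(Int.fract a, Int.fract b), ⟨⟨Int.fract_nonneg _, (Int.fract_lt_one _).le⟩,
      ⟨Int.fract_nonneg _, (Int.fract_lt_one _).le⟩⟩, rfl⟩, ?_⟩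
    rw [← hper _ (mem_lattice.2 ⟨⌊a⌋, ⌊b⌋, rfl⟩)]
    congr 1
    rw [hz]
    simp only [Int.fract]
    push_cast
    ring
  obtain ⟨γ, hγ⟩ := hderiv.exists_const_forall_eq_of_bounded hbdd
  refine ⟨γ, F 0, fun z => ?_⟩
  have h := is_const_of_deriv_eq_zero (f := fun z => F z - γ * z) (by fun_prop) (fun z => by
    rw [deriv_fun_sub (hF z) (by fun_prop), hγ]
    simp) z 0
  simp only [mul_zero, sub_zero] at h
  linear_combination h

end Torus

/-! ### Curves with one node -/

section Node

variable {X : Type} {P₁ P₂ : X}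

theorem proj_eq_proj {a b : X} : (nodeModulus P₁ P₂).proj a = (nodeModulus P₁ P₂).proj b ↔
    a = b ∨ (a = P₁ ∨ a = P₂) ∧ (b = P₁ ∨ b = P₂) := by
  refine Quotient.eq.trans (or_congr_right ⟨?_, ?_⟩)
  · rintro ⟨ha, hb, -⟩
    exact ⟨ha, hb⟩
  · rintro ⟨ha, hb⟩
    exact ⟨ha, hb, trivial⟩

theorem proj_eq_node {a : X} : (nodeModulus P₁ P₂).proj a = (nodeModulus P₁ P₂).proj P₁ ↔
    a = P₁ ∨ a = P₂ := by
  rw [proj_eq_proj]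
  tauto

theorem proj_surjective : Function.Surjective (nodeModulus P₁ P₂).proj := Quotient.mk_surjective

theorem proj_out (q : (nodeModulus P₁ P₂).Curve) : (nodeModulus P₁ P₂).proj q.out = q :=
  Quotient.out_eq q

theorem out_proj {a : X} (ha : (nodeModulus P₁ P₂).proj a ≠ (nodeModulus P₁ P₂).proj P₁) :
    ((nodeModulus P₁ P₂).proj a).out = a := by
  rcases proj_eq_proj.1 (proj_out ((nodeModulus P₁ P₂).proj a)) with h | ⟨-, h⟩
  · exact h
  · exact absurd (proj_eq_node.2 h) ha

theorem finite_preimage_proj (q : (nodeModulus P₁ P₂).Curve) :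
    ((nodeModulus P₁ P₂).proj ⁻¹' {q}).Finite := by
  obtain ⟨b, rfl⟩ := proj_surjective q
  refine (Set.toFinite {b, P₁, P₂}).subset fun a ha => ?_
  rcases proj_eq_proj.1 (show (nodeModulus P₁ P₂).proj a = _ from ha) with h | ⟨h, -⟩
  · exact Or.inl h
  · exact Or.inr h

theorem mem_image_proj_diff {U : Set X} {q : (nodeModulus P₁ P₂).Curve} :
    q ∈ (nodeModulus P₁ P₂).proj '' (U \ {P₁, P₂}) ↔
      q ≠ (nodeModulus P₁ P₂).proj P₁ ∧ q.out ∈ U := by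
  constructor
  · rintro ⟨a, ⟨haU, ha⟩, rfl⟩
    have hne : (nodeModulus P₁ P₂).proj a ≠ (nodeModulus P₁ P₂).proj P₁ :=
      fun h => ha (proj_eq_node.1 h)
    exact ⟨hne, by rwa [out_proj hne]⟩
  · rintro ⟨hq, hU⟩
    refine ⟨q.out, ⟨hU, fun h => hq ?_⟩, proj_out q⟩
    rw [← proj_out q]
    exact proj_eq_node.2 h

variable [TopologicalSpace X]

theorem continuous_proj : Continuous (nodeModulus P₁ P₂).proj := continuous_quot_mk

/-- The image of an open set which contains both or none of the identified points is open. -/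
theorem isOpen_image_proj {U : Set X} (hU : IsOpen U) (h : P₁ ∈ U ↔ P₂ ∈ U) :
    IsOpen ((nodeModulus P₁ P₂).proj '' U) := by
  have e : (nodeModulus P₁ P₂).proj ⁻¹' ((nodeModulus P₁ P₂).proj '' U) = U := by
    refine Set.Subset.antisymm ?_ (Set.subset_preimage_image _ _)
    rintro a ⟨b, hb, hab⟩
    rcases proj_eq_proj.1 hab with rfl | ⟨rfl | rfl, rfl | rfl⟩ <;> tauto
  exact isOpen_coinduced.2 (by rw [← e] at hU; exact hU)

theorem isOpen_image_proj_diff [T1Space X] {U : Set X} (hU : IsOpen U) :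
    IsOpen ((nodeModulus P₁ P₂).proj '' (U \ {P₁, P₂})) :=
  isOpen_image_proj (hU.sdiff (Set.toFinite _).isClosed) (by simp)

/-- Away from the node, the normalization has a continuous inverse. -/
theorem continuousAt_out [T1Space X] {q : (nodeModulus P₁ P₂).Curve}
    (hq : q ≠ (nodeModulus P₁ P₂).proj P₁) :
    ContinuousAt (fun q : (nodeModulus P₁ P₂).Curve => q.out) q := by
  intro N hN
  obtain ⟨U, hUN, hU, hqU⟩ := mem_nhds_iff.1 hN
  rw [mem_map]
  filter_upwards [(isOpen_image_proj_diff hU).mem_nhds (mem_image_proj_diff.2 ⟨hq, hqU⟩)] with p hp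
  exact hUN (mem_image_proj_diff.1 hp).2

/-- A map to the nodal curve, on a space whose punctured neighbourhoods are connected and which
hits the node in isolated points only, has a limit when lifted to the normalization: a connected
punctured neighbourhood of a point over the node stays on one branch of the node. -/
theorem exists_tendsto_out [T2Space X] (hne : P₁ ≠ P₂) {Y : Type*} [TopologicalSpace Y] {y : Y}
    (hconn : ∀ T ∈ 𝓝[≠] y, ∃ W ∈ 𝓝[≠] y, W ⊆ T ∧ IsPreconnected W)
    {ψ : Y → (nodeModulus P₁ P₂).Curve} (hψ : Continuous ψ)
    (hiso : ∀ᶠ t in 𝓝[≠] y, ψ t ≠ (nodeModulus P₁ P₂).proj P₁) :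
    ∃ x : X, (nodeModulus P₁ P₂).proj x = ψ y ∧
      Tendsto (fun t => (ψ t).out) (𝓝[≠] y) (𝓝 x) := by
  by_cases hy : ψ y = (nodeModulus P₁ P₂).proj P₁
  swap
  · exact ⟨(ψ y).out, proj_out _, ((continuousAt_out hy).comp
      (f := ψ) hψ.continuousAt).tendsto.mono_left nhdsWithin_le_nhds⟩
  obtain ⟨U₁, U₂, hU₁, hU₂, h₁, h₂, hdisj⟩ := t2_separation hne
  -- If all values near `y` lie on the branch `x₁ ∈ V₁`, the lifts converge to `x₁`.
  have key : ∀ {V₁ V₂ : Set X} {x₁ x₂ : X}, IsOpen V₁ → IsOpen V₂ → x₁ ∈ V₁ → x₂ ∈ V₂ →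
      Disjoint V₁ V₂ → (x₁ = P₁ ∧ x₂ = P₂ ∨ x₁ = P₂ ∧ x₂ = P₁) →
      (∀ᶠ t in 𝓝[≠] y, (ψ t).out ∈ V₁) → Tendsto (fun t => (ψ t).out) (𝓝[≠] y) (𝓝 x₁) := by
    intro V₁ V₂ x₁ x₂ hV₁ hV₂ hx₁ hx₂ hd hx hev N hN
    obtain ⟨O, hON, hO, hxO⟩ := mem_nhds_iff.1 hN
    have hopen : IsOpen ((nodeModulus P₁ P₂).proj '' (O ∪ V₂)) :=
      isOpen_image_proj (hO.union hV₂) (by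
        rcases hx with ⟨rfl, rfl⟩ | ⟨rfl, rfl⟩ <;> simp [hxO, hx₂])
    have hmem : ψ y ∈ (nodeModulus P₁ P₂).proj '' (O ∪ V₂) := by
      refine ⟨x₁, Or.inl hxO, ?_⟩
      rw [hy]
      exact proj_eq_node.2 (by tauto)
    rw [mem_map]
    filter_upwards [hev, hiso, mem_nhdsWithin_of_mem_nhds
      (hψ.continuousAt (hopen.mem_nhds hmem))] with t ht1 ht2 ht3
    obtain ⟨a, ha, hat⟩ := ht3
    rw [← hat, out_proj (by rwa [hat])] at ht1
    rw [Set.mem_preimage, ← hat, out_proj (by rwa [hat])]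
    exact hON (ha.resolve_right fun h => Set.disjoint_left.1 hd ht1 h)
  have hopen : IsOpen ((nodeModulus P₁ P₂).proj '' (U₁ ∪ U₂)) :=
    isOpen_image_proj (hU₁.union hU₂) (by simp [h₁, h₂])
  have hmem : ψ y ∈ (nodeModulus P₁ P₂).proj '' (U₁ ∪ U₂) := ⟨P₁, Or.inl h₁, hy.symm⟩
  obtain ⟨W, hW, hWT, hWc⟩ := hconn _ (inter_mem hiso (mem_nhdsWithin_of_mem_nhds
      (hψ.continuousAt (hopen.mem_nhds hmem))))
  have hdisj' : Disjoint (ψ ⁻¹' ((nodeModulus P₁ P₂).proj '' (U₁ \ {P₁, P₂})))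
      (ψ ⁻¹' ((nodeModulus P₁ P₂).proj '' (U₂ \ {P₁, P₂}))) := by
    refine Set.disjoint_left.2 fun t ht1 ht2 => ?_
    exact Set.disjoint_left.1 hdisj (mem_image_proj_diff.1 ht1).2 (mem_image_proj_diff.1 ht2).2
  have hcover : W ⊆ ψ ⁻¹' ((nodeModulus P₁ P₂).proj '' (U₁ \ {P₁, P₂})) ∪
      ψ ⁻¹' ((nodeModulus P₁ P₂).proj '' (U₂ \ {P₁, P₂})) := by
    intro t ht
    obtain ⟨ht1, a, ha, hat⟩ := hWT ht
    have hout : (ψ t).out = a := by rw [← hat, out_proj (by rw [hat]; exact ht1)]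
    rcases ha with ha | ha
    · exact Or.inl (mem_image_proj_diff.2 ⟨ht1, by rwa [hout]⟩)
    · exact Or.inr (mem_image_proj_diff.2 ⟨ht1, by rwa [hout]⟩)
  rcases hWc.subset_or_subset ((isOpen_image_proj_diff hU₁).preimage hψ)
    ((isOpen_image_proj_diff hU₂).preimage hψ) hdisj' hcover with h | h
  · refine ⟨P₁, hy.symm, key hU₁ hU₂ h₁ h₂ hdisj (Or.inl ⟨rfl, rfl⟩) ?_⟩
    filter_upwards [hW] with t ht using (mem_image_proj_diff.1 (h ht)).2
  · refine ⟨P₂, by rw [hy]; exact proj_eq_node.2 (Or.inr rfl),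
      key hU₂ hU₁ h₂ h₁ hdisj.symm (Or.inr ⟨rfl, rfl⟩) ?_⟩
    filter_upwards [hW] with t ht using (mem_image_proj_diff.1 (h ht)).2

/-- Maps to the nodal curve which hit the node in isolated points lift to the normalization. -/
theorem exists_continuous_lift [T2Space X] (hne : P₁ ≠ P₂) {Y : Type*} [TopologicalSpace Y]
    (hconn : ∀ y : Y, ∀ T ∈ 𝓝[≠] y, ∃ W ∈ 𝓝[≠] y, W ⊆ T ∧ IsPreconnected W)
    {ψ : Y → (nodeModulus P₁ P₂).Curve} (hψ : Continuous ψ)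
    (hiso : ∀ y, ∀ᶠ t in 𝓝[≠] y, ψ t ≠ (nodeModulus P₁ P₂).proj P₁) :
    ∃ φ : Y → X, Continuous φ ∧ ∀ y, (nodeModulus P₁ P₂).proj (φ y) = ψ y := by
  choose φ hφ hlim using fun y => exists_tendsto_out hne (hconn y) hψ (hiso y)
  refine ⟨φ, continuous_iff_continuousAt.2 fun y => continuousWithinAt_compl_self.1 ?_, hφ⟩
  refine (hlim y).congr' ?_
  filter_upwards [hiso y] with t ht
  rw [← hφ t] at ht ⊢
  exact out_proj ht

end Node

/-! ### Isomorphisms of nodal curves over a torus -/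

section Main

variable {τ : UpperHalfPlane}

/-- At a node, the functions whose pull-back is holomorphic form the stalk: the values of the
pull-back at the two points over the node agree automatically. -/
theorem memStalk_nodeModulus {P₁ P₂ : Torus τ} {g : (nodeModulus P₁ P₂).Curve → ℂ}
    {Q : (nodeModulus P₁ P₂).Curve} : (nodeModulus P₁ P₂).MemStalk g Q ↔
      ∀ P : Torus τ, (nodeModulus P₁ P₂).proj P = Q →
        IsHolomorphicAt (g ∘ (nodeModulus P₁ P₂).proj) P := by
  refine ⟨fun h => h.1, fun h => ⟨h, g Q, fun P hP z hz => ?_⟩⟩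
  have hne : analyticOrderAt
      (fun w : ℂ => g ((nodeModulus P₁ P₂).proj (w : Torus τ)) - g Q) z ≠ 0 :=
    analyticOrderAt_ne_zero.2 ⟨(h P hP z hz).sub analyticAt_const, by rw [hz, hP, sub_self]⟩
  exact Order.one_le_iff_pos.2 (pos_iff_ne_zero.2 hne)

/-- The affine self-map of the torus induced by `z ↦ γ z + β`. -/
def affineMap (γ β : ℂ) (hγ : γ ∈ multipliers (lattice τ)) : Torus τ → Torus τ :=
  fun P => QuotientAddGroup.map (lattice τ) (lattice τ) (AddMonoidHom.mulLeft γ)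
    (fun l hl => hγ l hl) P + (β : Torus τ)

theorem affineMap_mk (γ β : ℂ) (hγ : γ ∈ multipliers (lattice τ)) (z : ℂ) :
    affineMap γ β hγ (z : Torus τ) = ((γ * z + β : ℂ) : Torus τ) := rfl

theorem continuous_affineMap (γ β : ℂ) (hγ : γ ∈ multipliers (lattice τ)) :
    Continuous (affineMap γ β hγ) :=
  (QuotientAddGroup.isOpenQuotientMap_mk.isQuotientMap.continuous_iff).2
    ((isCoveringMap_mk τ).continuous.comp (show Continuous fun z : ℂ => γ * z + β by fun_prop))

/-- Pull-back of holomorphic functions along a map of nodal curves induced by an affine map. -/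
theorem memStalk_comp {P₁ P₂ P₁' P₂' : Torus τ} {γ β : ℂ} (hγ : γ ∈ multipliers (lattice τ))
    {f : (nodeModulus P₁ P₂).Curve → (nodeModulus P₁' P₂').Curve}
    (hf : ∀ P, f ((nodeModulus P₁ P₂).proj P) = (nodeModulus P₁' P₂').proj (affineMap γ β hγ P))
    {g : (nodeModulus P₁' P₂').Curve → ℂ} {Q : (nodeModulus P₁ P₂).Curve}
    (h : (nodeModulus P₁' P₂').MemStalk g (f Q)) : (nodeModulus P₁ P₂).MemStalk (g ∘ f) Q := by
  rw [memStalk_nodeModulus] at h ⊢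
  rintro P rfl z rfl
  have hg := h _ (hf _).symm (γ * z + β) (affineMap_mk γ β hγ z).symm
  have hc : AnalyticAt ℂ (fun w : ℂ => γ * w + β) z := by fun_prop
  refine (AnalyticAt.comp (f := fun w : ℂ => γ * w + β) hg hc).congr (Eventually.of_forall ?_)
  intro w
  simp only [Function.comp_apply, hf, affineMap_mk]

/-- An affine map with `γ Γ_τ = Γ_τ` which maps `P₁, P₂` to `P₁', P₂'` induces an isomorphism of
the nodal curves. -/
theorem biholomorphic_of_affine {P₁ P₂ P₁' P₂' : Torus τ} {γ : ℂ} (β : ℂ) (h0 : γ ≠ 0)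
    (hγ : γ ∈ multipliers (lattice τ)) (hγ' : γ⁻¹ ∈ multipliers (lattice τ))
    (h₁ : affineMap γ β hγ P₁ = P₁') (h₂ : affineMap γ β hγ P₂ = P₂') :
    Biholomorphic (nodeModulus P₁ P₂) (nodeModulus P₁' P₂') := by
  have hleft : ∀ P, affineMap γ⁻¹ (-(γ⁻¹ * β)) hγ' (affineMap γ β hγ P) = P := by
    intro P
    obtain ⟨z, rfl⟩ := QuotientAddGroup.mk_surjective P
    rw [affineMap_mk, affineMap_mk]
    congr 1
    field_simp
    ring
  have hright : ∀ P, affineMap γ β hγ (affineMap γ⁻¹ (-(γ⁻¹ * β)) hγ' P) = P := by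
    intro P
    obtain ⟨z, rfl⟩ := QuotientAddGroup.mk_surjective P
    rw [affineMap_mk, affineMap_mk]
    congr 1
    field_simp
    ring
  have h₁' : affineMap γ⁻¹ (-(γ⁻¹ * β)) hγ' P₁' = P₁ := by rw [← h₁, hleft]
  have h₂' : affineMap γ⁻¹ (-(γ⁻¹ * β)) hγ' P₂' = P₂ := by rw [← h₂, hleft]
  -- A map carrying one pair of points to another descends to the nodal curves.
  have descend : ∀ {Q₁ Q₂ Q₁' Q₂' : Torus τ} {φ : Torus τ → Torus τ}, φ Q₁ = Q₁' → φ Q₂ = Q₂' →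
      ∀ P R, (nodeModulus Q₁ Q₂).glue P R →
        (nodeModulus Q₁' Q₂').proj (φ P) = (nodeModulus Q₁' Q₂').proj (φ R) := by
    rintro Q₁ Q₂ _ _ φ rfl rfl P R h
    rcases proj_eq_proj.1 (Quotient.sound h :
      (nodeModulus Q₁ Q₂).proj P = (nodeModulus Q₁ Q₂).proj R) with rfl | ⟨hP, hR⟩
    · rfl
    · refine proj_eq_proj.2 (Or.inr ⟨?_, ?_⟩)
      · rcases hP with rfl | rfl <;> simp
      · rcases hR with rfl | rfl <;> simp
  let f : (nodeModulus P₁ P₂).Curve ≃ₜ (nodeModulus P₁' P₂').Curve :=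
    { toFun := Quotient.lift _ (descend h₁ h₂)
      invFun := Quotient.lift _ (descend h₁' h₂')
      left_inv := by
        intro q
        obtain ⟨P, rfl⟩ := proj_surjective q
        exact congrArg _ (hleft P)
      right_inv := by
        intro q
        obtain ⟨P, rfl⟩ := proj_surjective q
        exact congrArg _ (hright P)
      continuous_toFun := continuous_quot_lift _
        (continuous_proj.comp (continuous_affineMap γ β hγ))
      continuous_invFun := continuous_quot_lift _
        (continuous_proj.comp (continuous_affineMap γ⁻¹ (-(γ⁻¹ * β)) hγ')) }
  refine ⟨f, fun V g => ⟨fun hg Q hQ => ?_, fun hg Q hQ => ?_⟩⟩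
  · exact memStalk_comp hγ (fun P => rfl) (hg (f Q) hQ)
  · have hQ' : f (f.symm Q) ∈ V := by rwa [f.apply_symm_apply]
    have := memStalk_comp (f := f.symm) (β := -(γ⁻¹ * β)) hγ' (fun P => rfl) (hg (f.symm Q) hQ')
    rwa [show (g ∘ f) ∘ f.symm = g from funext fun q => congrArg g (f.apply_symm_apply q)] at this

/-- The lift to the plane of an isomorphism of nodal curves is entire. Away from the node this
is seen by pulling back a local coordinate of the torus, which is a section of the structure
sheaf; the remaining points are isolated, and removable by continuity. -/
theorem differentiable_lift {P₁ P₂ P₁' P₂' : Torus τ}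
    (f : (nodeModulus P₁ P₂).Curve ≃ₜ (nodeModulus P₁' P₂').Curve)
    (hf : ∀ (V : TopologicalSpace.Opens (nodeModulus P₁' P₂').Curve)
      (g : (nodeModulus P₁' P₂').Curve → ℂ), g ∈ (nodeModulus P₁' P₂').sections V →
        g ∘ f ∈ (nodeModulus P₁ P₂).sections
          (TopologicalSpace.Opens.comap ⟨f, f.continuous⟩ V))
    (hiso : ∀ P : Torus τ, ∀ᶠ x in 𝓝[≠] P,
      f ((nodeModulus P₁ P₂).proj x) ≠ (nodeModulus P₁' P₂').proj P₁')
    {F : ℂ → ℂ} (hF : Continuous F)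
    (hFf : ∀ z : ℂ, (nodeModulus P₁' P₂').proj (F z : Torus τ) =
      f ((nodeModulus P₁ P₂).proj (z : Torus τ))) : Differentiable ℂ F := by
  have hgood : ∀ z : ℂ, f ((nodeModulus P₁ P₂).proj (z : Torus τ)) ≠
      (nodeModulus P₁' P₂').proj P₁' → AnalyticAt ℂ F z := by
    intro z hz
    obtain ⟨h, U, hU, hzU, hh⟩ := exists_local_inverse (τ := τ) (F z)
    have hUo : IsOpen ((fun w : ℂ => (w : Torus τ)) '' U) := (isCoveringMap_mk τ).isOpenMap U hU
    have hV : (fun q => h q.out) ∈ (nodeModulus P₁' P₂').sections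
        ⟨_, isOpen_image_proj_diff (P₁ := P₁') (P₂ := P₂') hUo⟩ := by
      intro Q hQ
      rw [memStalk_nodeModulus]
      obtain ⟨hQ, u, huU, hu⟩ := mem_image_proj_diff.1 hQ
      rintro P rfl z' rfl
      rw [out_proj hQ] at hu
      have hl : AnalyticAt ℂ (fun w : ℂ => w - (z' - u)) z' := by fun_prop
      have hlU : ∀ᶠ w : ℂ in 𝓝 z', w - (z' - u) ∈ U :=
        hl.continuousAt (hU.mem_nhds (by simpa using huU))
      -- Points near `z'` stay away from the node.
      have hne : ∀ᶠ w : ℂ in 𝓝 z', (w : Torus τ) ∉ ({P₁', P₂'} : Set (Torus τ)) :=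
        (isCoveringMap_mk τ).continuous.continuousAt
          ((Set.toFinite {P₁', P₂'}).isClosed.isOpen_compl.mem_nhds
            fun hmem => hQ (proj_eq_node.2 hmem))
      refine hl.congr ?_
      filter_upwards [hlU, hne] with w hw hwne
      rw [Function.comp_apply, out_proj fun e => hwne (proj_eq_node.1 e)]
      have e : (w : Torus τ) = ((w - (z' - u) : ℂ) : Torus τ) := by
        rw [mk_eq_mk]
        have := mk_eq_mk.1 hu
        rw [show w - (z' - u) - w = -(z' - u) by ring]
        exact neg_mem this
      rw [e, hh _ hw]
    have hmem : f ((nodeModulus P₁ P₂).proj (z : Torus τ)) ∈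
        (nodeModulus P₁' P₂').proj '' ((fun w : ℂ => (w : Torus τ)) '' U \ {P₁', P₂'}) := by
      refine mem_image_proj_diff.2 ⟨hz, F z, hzU, ?_⟩
      rw [← hFf z] at hz ⊢
      exact (out_proj hz).symm
    refine (memStalk_nodeModulus.1 (hf _ _ hV _ hmem) _ rfl z rfl).congr ?_
    have hcont : Continuous fun w : ℂ => f ((nodeModulus P₁ P₂).proj (w : Torus τ)) :=
      f.continuous.comp (continuous_proj.comp (isCoveringMap_mk τ).continuous)
    filter_upwards [hF.continuousAt (hU.mem_nhds hzU), hcont.continuousAt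
      ((isOpen_image_proj_diff hUo).mem_nhds hmem)] with w hw hw'
    have hwne : f ((nodeModulus P₁ P₂).proj (w : Torus τ)) ≠ (nodeModulus P₁' P₂').proj P₁' :=
      (mem_image_proj_diff.1 hw').1
    simp only [Function.comp_apply]
    rw [← hFf w] at hwne ⊢
    rw [out_proj hwne, hh _ hw]
  intro z
  refine (Complex.analyticAt_of_differentiable_on_punctured_nhds_of_continuousAt ?_
    hF.continuousAt).differentiableAt
  filter_upwards [tendsto_mk_punctured z (hiso (z : Torus τ))] with w hw
  exact (hgood w hw).differentiableAt

/-- An isomorphism of nodal curves over the torus is induced by an affine map. -/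
theorem exists_affine_of_biholomorphic {P₁ P₂ P₁' P₂' : Torus τ} (hP' : P₁' ≠ P₂')
    (h : Biholomorphic (nodeModulus P₁ P₂) (nodeModulus P₁' P₂')) :
    ∃ (f : (nodeModulus P₁ P₂).Curve ≃ₜ (nodeModulus P₁' P₂').Curve) (φ : Torus τ → Torus τ)
      (γ β : ℂ), (∀ P, (nodeModulus P₁' P₂').proj (φ P) = f ((nodeModulus P₁ P₂).proj P)) ∧
        ∀ z : ℂ, φ (z : Torus τ) = ((γ * z + β : ℂ) : Torus τ) := by
  obtain ⟨f, hf⟩ := h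
  have hiso : ∀ P : Torus τ, ∀ᶠ x in 𝓝[≠] P,
      f ((nodeModulus P₁ P₂).proj x) ≠ (nodeModulus P₁' P₂').proj P₁' := by
    intro P
    have hfin := finite_preimage_proj (f.symm ((nodeModulus P₁' P₂').proj P₁'))
    have := (hfin.subset Set.sdiff_subset (t := _ \ {P})).isClosed.isOpen_compl.mem_nhds
      (x := P) (by simp)
    filter_upwards [mem_nhdsWithin_of_mem_nhds this, self_mem_nhdsWithin] with x hx hxP e
    exact hx ⟨by rw [← e]; simp, hxP⟩
  obtain ⟨φ, hφ, hφf⟩ := exists_continuous_lift hP' exists_preconnected_punctured_nhds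
    (f.continuous.comp continuous_proj) hiso
  obtain ⟨F, hF, hFφ⟩ := exists_lift_plane hφ
  obtain ⟨γ, β, hγ⟩ := exists_affine_of_lift
    (differentiable_lift f (fun V g => (hf V g).1) hiso hF fun z => by rw [hFφ]; exact hφf _) hFφ
  exact ⟨f, φ, γ, β, hφf, fun z => by rw [← hFφ, hγ]⟩

/-- If a self-map of the torus induced by `z ↦ γ z + β` lifts an injective map of nodal curves,
it is injective: if two points have the same image, so have their translates by the same vector, and
a suitable translation moves the first of them away from the points over the node. -/
theorem injective_of_affine {P₁ P₂ P₁' P₂' : Torus τ}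
    {f : (nodeModulus P₁ P₂).Curve → (nodeModulus P₁' P₂').Curve} (hf : f.Injective)
    {φ : Torus τ → Torus τ} {γ β : ℂ}
    (hφf : ∀ P, (nodeModulus P₁' P₂').proj (φ P) = f ((nodeModulus P₁ P₂).proj P))
    (hφ : ∀ z : ℂ, φ (z : Torus τ) = ((γ * z + β : ℂ) : Torus τ)) {z w : ℂ}
    (h : γ * w - γ * z ∈ lattice τ) : w - z ∈ lattice τ := by
  -- The torus has points other than `P₁` and `P₂`.
  obtain ⟨t, ht⟩ : ∃ t : ℂ, (t : Torus τ) ∉ ({P₁, P₂} : Set (Torus τ)) := by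
    have hfin : (({P₁, P₂} : Set (Torus τ)) \ {((0 : ℂ) : Torus τ)}).Finite := Set.toFinite _
    have := tendsto_mk_punctured (τ := τ) 0 (inter_mem self_mem_nhdsWithin
      (mem_nhdsWithin_of_mem_nhds (hfin.isClosed.isOpen_compl.mem_nhds (by simp))))
    obtain ⟨t, ht1, ht2⟩ := nonempty_of_mem (mem_map.1 this)
    exact ⟨t, fun hm => ht2 ⟨hm, ht1⟩⟩
  have e : φ (t : Torus τ) = φ ((t + (w - z) : ℂ) : Torus τ) := by
    rw [hφ, hφ, mk_eq_mk]
    convert h using 1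
    ring
  have e' := hf ((hφf _).symm.trans ((congrArg _ e).trans (hφf _)))
  rcases proj_eq_proj.1 e' with e' | ⟨e', -⟩
  · simpa using mk_eq_mk.1 e'
  · exact absurd e' ht

end Main

end SingularCurve

open SingularCurve in
theorem proposition6p5 (τ : UpperHalfPlane) (z₁ z₂ z₁' z₂' : ℂ)
    (hz : (z₁ : SingularCurve.Torus τ) ≠ (z₂ : SingularCurve.Torus τ))
    (hz' : (z₁' : SingularCurve.Torus τ) ≠ (z₂' : SingularCurve.Torus τ)) :
    SingularCurve.Biholomorphic
        (SingularCurve.nodeModulus (z₁ : SingularCurve.Torus τ) (z₂ : SingularCurve.Torus τ))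
        (SingularCurve.nodeModulus (z₁' : SingularCurve.Torus τ) (z₂' : SingularCurve.Torus τ)) ↔
      ∃ γ : ℂ, SingularCurve.IsAdmissible τ γ ∧
        (z₁' - z₂') - γ * (z₁ - z₂) ∈ SingularCurve.lattice τ := by
  constructor
  · intro h
    obtain ⟨f, φ, γ, β, hφf, hφ⟩ := exists_affine_of_biholomorphic hz' h
    have hinj : ∀ {z w : ℂ}, γ * w - γ * z ∈ lattice τ → w - z ∈ lattice τ :=
      fun h => injective_of_affine f.injective hφf hφ h
    have hmul : γ ∈ multipliers (lattice τ) := by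
      intro l hl
      have e : φ ((0 : ℂ) : Torus τ) = φ (l : Torus τ) := by
        rw [mk_eq_mk.2 (show l - 0 ∈ lattice τ by simpa using hl)]
      rw [hφ, hφ, mk_eq_mk] at e
      simpa using e
    have h0 : γ ≠ 0 := by
      rintro rfl
      exact hz (mk_eq_mk.2 (hinj (by simp)))
    have hinv : γ⁻¹ ∈ multipliers (lattice τ) := by
      intro l hl
      have := hinj (z := 0) (w := γ⁻¹ * l) (by simpa [mul_inv_cancel_left₀ h0] using hl)
      simpa using this
    have hadm := isAdmissible_of_mem_multipliers h0 hmul hinv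
    have hadm' := isAdmissible_of_mem_multipliers (neg_ne_zero.2 h0) (neg_mem hmul)
      (by rw [inv_neg]; exact neg_mem hinv)
    -- The two points over the node go to distinct points over one point, so these are the points
    -- over the node of the other curve, in one of the two possible orders.
    have hproj : (nodeModulus (z₁' : Torus τ) (z₂' : Torus τ)).proj (φ z₁) =
        (nodeModulus (z₁' : Torus τ) (z₂' : Torus τ)).proj (φ z₂) := by
      rw [hφf, hφf, proj_eq_node.2 (Or.inr rfl)]
    have hne : φ z₁ ≠ φ z₂ := by
      rw [hφ, hφ, Ne, mk_eq_mk]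
      exact fun h => hz (mk_eq_mk.2 (hinj (by simpa using h)))
    obtain ⟨h₁, h₂⟩ := (proj_eq_proj.1 hproj).resolve_left hne
    rw [hφ] at hne h₁ h₂
    rw [hφ] at hne
    rcases h₁ with h₁ | h₁ <;> rcases h₂ with h₂ | h₂
    · exact absurd (h₁.trans h₂.symm) hne
    · refine ⟨γ, hadm, ?_⟩
      convert sub_mem (mk_eq_mk.1 h₁) (mk_eq_mk.1 h₂) using 1
      ring
    · refine ⟨-γ, hadm', ?_⟩
      convert sub_mem (mk_eq_mk.1 h₂) (mk_eq_mk.1 h₁) using 1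
      ring
    · exact absurd (h₁.trans h₂.symm) hne
  · rintro ⟨γ, hadm, hγ⟩
    obtain ⟨h0, hmul, hinv⟩ := hadm.mem_multipliers
    refine biholomorphic_of_affine (z₁' - γ * z₁) h0 hmul hinv ?_ ?_
    · rw [affineMap_mk]
      congr 1
      ring
    · rw [affineMap_mk, mk_eq_mk]
      convert neg_mem hγ using 1
      ring
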